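/- **Setting.** An instance consists of agents $N=\{1,\dots,n\}$, a budget $B>0$, costs $c_i>0$ (reported truthfully), and a normalised ($v(\emptyset)=0$), non-negative, submodular, not necessarily monotone valuation $v:2^N\to\mathbb{R}_{\ge 0}$. Write $v(i\mid S)=v(S\cup\{i\})-v(S)$ and $v(i)=v(\{i\})$. A set $S$ is feasible if $\sum_{i\in S}c_i\le B$, and $S^*$ is a feasible set of maximum value. The agents arrive one at a time, in a uniformly random order. All coins below are independent of each other and of the order. *Posted prices with threshold $t$ on a sequence of agents.* Draw $j\in\{1,2\}$ uniformly beforehand. Start with $S_1=S_2=\emptyset$ and $B_1=B_2=B$. When $i$ arrives, let $j(i)\in\arg\max_{k\in\{1,2\}}v(i\mid S_k)$ (ties to $1$) and $\bar p_i=\frac{B}{t}\,v(i\mid S_{j(i)})$. If $c_i\le\bar p_i\le B_{j(i)}$, add $i$ to $S_{j(i)}$ at price $\bar p_i$ and replace $B_{j(i)}$ by $B_{j(i)}-\bar p_i$. If $t=0$, nobody is added. Return $S_j$; its members are paid their prices and all other agents are paid $0$. *Prediction-based mechanism (parameters $p,a,z$; prediction $\omega$).* With probability $p$, hire the first agent $i$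 with $v(i)\ge a\omega/z$ (if there is one) and pay her $B$. With probability $1-p$, run posted prices with threshold $t=a\omega$ on all agents. *Sampling-based mechanism (parameters $q,\beta$).* With probability $q$, run Dynkin's algorithm: observe the first $\lfloor n/e\rfloor$ agents without hiring, then hire the first later agent whose value $v(i)$ is at least that of every observed agent (if there is one) and pay her $B$; here equal values are compared by a fixed tie-breaking order on the agents. With probability $1-q$, draw $\xi$ from the binomial distribution $\mathcal B(n,\frac12)$, let $N_1$ be the set of the first $\xi$ agents, let $T_1\subseteq N_1$ be a $1/e$-approximate solution of the offline problem on $N_1$ (i.e. $T_1$ is feasible and $v(T_1)\ge v(U)/e$ for every feasible $U\subseteq N_1$), and run posted prices with threshold $t=\beta\, v(T_1)$ on the remaining agents. The approximate solution may come from any algorithm with this guarantee. *Mechanism $M_\tau$ (tolerance $\tau\in[0,1)$).* With probability $\tau$ run the prediction-based mechanism, and with probability $1-\tau$ the sampling-based one. Let $A$ be the set of hired agents; the expectation $\mathbb E$ is over the arrival order and all coins. **Statement.** Let $p=0.33$, $a=0.335$, $z=2$. For every instance and every $\tau\in[0,1)$: 1. (Consistency.) With $q=0.66$, $\beta=0.1664$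 and a perfect prediction $\omega=v(S^*)$, $$v(S^*)\le\Big(\tau\cdot\tfrac1{19}+(1-\tau)\cdot\tfrac1{445}\Big)^{-1}\,\mathbb E[v(A)].$$ 2. (Robustness.) With $q=0.63$, $\beta=0.171$ and an erroneous prediction $\omega=(1-\varepsilon)\,v(S^*)$, for every $\varepsilon\in(0,1)$, $$v(S^*)\le\Big(\tau\cdot\tfrac1{19}\cdot(1-\varepsilon)+(1-\tau)\cdot\tfrac1{445}\Big)^{-1}\,\mathbb E[v(A)].$$ 3. (No prediction.) For $\tau=0$ and either choice of $(q,\beta)$, the outcome almost surely does not depend on $\omega$, and $v(S^*)\le 445\,\mathbb E[v(A)]$. -/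

import Mathlib

open Finset

noncomputable section

namespace BudgetMech

/-- The marginal value `v(i | S) = v(S ∪ {i}) - v(S)`. -/
def marginal {n : ℕ} (v : Finset (Fin n) → ℝ) (i : Fin n) (S : Finset (Fin n)) : ℝ :=
  v (insert i S) - v S

/-- An instance `(N, c, v, B)` with `N = Fin n`: a budget `B > 0`, positive costs, and a normalised,
non-negative, submodular (not necessarily monotone) valuation `v`. Agents report truthfully, so
`cost` is also the profile of declared costs. -/
structure Instance (n : ℕ) where
  budget : ℝ
  budget_pos : 0 < budget
  cost : Fin n → ℝ
  cost_pos : ∀ i, 0 < cost i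
  value : Finset (Fin n) → ℝ
  value_empty : value ∅ = 0
  value_nonneg : ∀ S, 0 ≤ value S
  submodular : ∀ S U : Finset (Fin n), S ⊆ U → ∀ i, i ∉ U →
    marginal value i U ≤ marginal value i S

variable {n : ℕ}

/-- `S` is a feasible solution of `max v(S)` s.t. `∑_{i ∈ S} c_i ≤ B`, `S ⊆ N'`. -/
def Feasible (I : Instance n) (N' S : Finset (Fin n)) : Prop :=
  S ⊆ N' ∧ ∑ i ∈ S, I.cost i ≤ I.budget

/-- `S` is an optimal solution of the offline problem on all agents. -/
def IsOptimal (I : Instance n) (S : Finset (Fin n)) : Prop :=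
  Feasible I univ S ∧ ∀ U, Feasible I univ U → I.value U ≤ I.value S

/-- `alg N'` is, for every set `N'` of agents, a `1/e`-approximate solution of the offline problem
restricted to `N'`. -/
def IsApproxAlgorithm (I : Instance n) (alg : Finset (Fin n) → Finset (Fin n)) : Prop :=
  ∀ N', Feasible I N' (alg N') ∧
    ∀ U, Feasible I N' U → (1 / Real.exp 1) * I.value U ≤ I.value (alg N')

/-- What a mechanism returns: the hired agents and the payments. -/
structure Outcome (n : ℕ) where
  hired : Finset (Fin n)
  pay : Fin n → ℝ

/-- Hire at most one agent and pay her the whole budget. -/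
def hireOne (I : Instance n) : Option (Fin n) → Outcome n
  | none => ⟨∅, fun _ => 0⟩
  | some j => ⟨{j}, fun i => if i = j then I.budget else 0⟩

/-- The agents in order of arrival: agent `π t` arrives in slot `t`. -/
def arrivals (π : Equiv.Perm (Fin n)) : List (Fin n) := (List.finRange n).map π

/-! ### Posted prices with two disjoint candidate solutions -/

/-- The two candidate solutions, their remaining budgets, and the prices of the agents added. -/
structure State (n : ℕ) where
  sol : Fin 2 → Finset (Fin n)
  rem : Fin 2 → ℝ
  price : Fin n → ℝ

def initState (I : Instance n) : State n := ⟨fun _ => ∅, fun _ => I.budget, fun _ => 0⟩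

/-- `j(i)`: the candidate solution to which `i` has the larger marginal value (ties to the first). -/
def better (I : Instance n) (st : State n) (i : Fin n) : Fin 2 :=
  if marginal I.value i (st.sol 1) ≤ marginal I.value i (st.sol 0) then 0 else 1

/-- The price `(B / t) * v(i | S_{j(i)})` offered to `i`. For `t = 0` the Lean value of the quotient
is `0`; as costs are positive, then nobody is hired. -/
def offer (I : Instance n) (t : ℝ) (st : State n) (i : Fin n) : ℝ :=
  I.budget / t * marginal I.value i (st.sol (better I st i))

open Classical in
/-- The round in which agent `i` arrives. -/
def step (I : Instance n) (t : ℝ) (st : State n) (i : Fin n) : State n :=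
  let j := better I st i
  let r := offer I t st i
  if I.cost i ≤ r ∧ 0 ≤ st.rem j - r then
    ⟨Function.update st.sol j (insert i (st.sol j)),
      Function.update st.rem j (st.rem j - r),
      Function.update st.price i r⟩
  else st

/-- Process the agents of the list `l` in this order with threshold `t`, and return the candidate
solution with index `j` (drawn beforehand). -/
def postedPrice (I : Instance n) (t : ℝ) (l : List (Fin n)) (j : Fin 2) : Outcome n :=
  let st := l.foldl (step I t) (initState I)
  ⟨st.sol j, fun i => if i ∈ st.sol j then st.price i else 0⟩

/-! ### The prediction-based mechanism -/

open Classical in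
/-- The mechanism based on the prediction `ω`, for arrival order `π`, coin `c` (`true` with
probability `p`) and index `j` (uniform). -/
def predictionMech (I : Instance n) (a z ω : ℝ) (π : Equiv.Perm (Fin n)) (c : Bool) (j : Fin 2) :
    Outcome n :=
  if c then hireOne I ((arrivals π).find? fun i => decide (a * ω / z ≤ I.value {i}))
  else postedPrice I (a * ω) (arrivals π) j

/-! ### The sampling-based mechanism, which does not use the prediction -/

/-- Comparison of single agents by value, ties being broken by the agents' names. -/
def AtMost (I : Instance n) (i j : Fin n) : Prop :=
  I.value {i} < I.value {j} ∨ (I.value {i} = I.value {j} ∧ i ≤ j)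

open Classical in
/-- Dynkin's algorithm: among the agents after the first `⌊n/e⌋`, the first one that is at least as
good as the best (so, as all) of the first `⌊n/e⌋`. -/
def dynkin (I : Instance n) (π : Equiv.Perm (Fin n)) : Outcome n :=
  let m := ⌊(n : ℝ) / Real.exp 1⌋₊
  hireOne I (((arrivals π).drop m).find? fun j =>
    decide (∀ i ∈ (arrivals π).take m, AtMost I i j))

/-- The mechanism without prediction, for arrival order `π`, coin `c` (`true` with probability `q`),
sample size `ξ` (binomial) and index `j` (uniform). The first `ξ` agents form `N₁`, and `t` is
`β · v(T₁)` for the approximate solution `T₁ = alg N₁`. -/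
def samplingMech (I : Instance n) (alg : Finset (Fin n) → Finset (Fin n)) (β : ℝ)
    (π : Equiv.Perm (Fin n)) (c : Bool) (ξ : Fin (n + 1)) (j : Fin 2) : Outcome n :=
  if c then dynkin I π
  else postedPrice I (β * I.value (alg ((arrivals π).take ξ).toFinset)) ((arrivals π).drop ξ) j

/-! ### The combined mechanism -/

/-- Parameters: `p`, `a`, `z` of the prediction-based and `q`, `β` of the sampling-based mechanism. -/
structure Params where
  p : ℝ
  a : ℝ
  z : ℝ
  q : ℝ
  β : ℝ

/-- All the randomness of the combined mechanism and of the arrival order. -/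
structure Seed (n : ℕ) where
  order : Equiv.Perm (Fin n)
  coinMix : Bool
  coinPred : Bool
  coinSample : Bool
  ξ : Fin (n + 1)
  index : Fin 2

/-- The combined mechanism for a fixed seed; the mechanism with tolerance `τ` is its distribution
when the seed is drawn according to `seedProb`. -/
def combinedMech (I : Instance n) (alg : Finset (Fin n) → Finset (Fin n)) (P : Params) (ω : ℝ)
    (s : Seed n) : Outcome n :=
  if s.coinMix then predictionMech I P.a P.z ω s.order s.coinPred s.index
  else samplingMech I alg P.β s.order s.coinSample s.ξ s.index

/-- The law of a coin showing `true` with probability `x`. -/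
def coinProb (x : ℝ) (c : Bool) : ℝ := if c then x else 1 - x

/-- The law of the seed: all components are independent, the order is a uniform permutation, the
coins have success probabilities `τ`, `p`, `q`, the sample size is binomial `(n, 1/2)`, and the index
is uniform on two values. -/
def seedProb (τ : ℝ) (P : Params) (s : Seed n) : ℝ :=
  (1 / (n.factorial : ℝ)) * coinProb τ s.coinMix * coinProb P.p s.coinPred *
    coinProb P.q s.coinSample * ((n.choose s.ξ : ℝ) * (1 / 2) ^ n) * (1 / 2)

/-- The expectation of a function of the seed. -/
def expectation (τ : ℝ) (P : Params) (f : Seed n → ℝ) : ℝ :=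
  ∑ π : Equiv.Perm (Fin n), ∑ c₀ : Bool, ∑ c₁ : Bool, ∑ c₂ : Bool, ∑ ξ : Fin (n + 1), ∑ j : Fin 2,
    seedProb τ P ⟨π, c₀, c₁, c₂, ξ, j⟩ * f ⟨π, c₀, c₁, c₂, ξ, j⟩

/-- `E[v(A)]`, over the random arrival order and the coins of the combined mechanism. -/
def expectedValue (I : Instance n) (alg : Finset (Fin n) → Finset (Fin n)) (P : Params)
    (τ ω : ℝ) : ℝ :=
  expectation τ P fun s => I.value (combinedMech I alg P ω s).hired

/-- Parameters for the consistency guarantee. -/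
def consistencyParams : Params where
  p := 0.33
  a := 0.335
  z := 2
  q := 0.66
  β := 0.1664

/-- Parameters for the robustness guarantee. -/
def robustnessParams : Params where
  p := 0.33
  a := 0.335
  z := 2
  q := 0.63
  β := 0.171

end BudgetMech

end

/-! The expected value is the `τ`-mixture of the values of the two mechanisms (`expectedValue_eq`).
With `V` the optimum, it suffices that the prediction-based one earns `δV/19` when `ω = δV`, and the
sampling-based one `V/445`.

Posted prices (`postedPrice_value`): let no single agent be worth more than `m`. A candidate has
spent exactly `B/t` times its value, so an agent who accepts her price but exceeds the remaining
budget certifies a candidate worth more than `t - m`. If this never happens, every refused agent has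
marginal at most `t * c_i / B` to both candidates, so the refused part of a feasible `O` adds at
most `t` to either. The part of `O` inside the other candidate adds at most that candidate's value,
because each agent joined the candidate she helps more. Hence `v(S_k ∪ O) ≤ v(S_0) + v(S_1) + t`. As
`S_0` and `S_1` are disjoint, submodularity gives `v(O) ≤ v(S_0 ∪ O) + v(S_1 ∪ O)`, which replaces
monotonicity.

With a prediction, either some agent is worth `t/2` and is caught by the singleton branch, or `m =
t/2` works in posted prices; this holds for every arrival order.

Without one, let `m` be the largest singleton value. Dynkin's algorithm earns `m/5`, which suffices
if `V ≤ 50 m`. Otherwise the sample is a uniformly random set, and a variance bound for `S ↦ v(S ∩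
O)` shows that both halves of `O` keep value `2V/5` with probability at least `1 - 50 m/V`
(`IsOptimal.card_balanced`). The threshold then has the right order and posted prices succeed on the
second half. The two branches together give a quadratic in `m/V` that stays above `1/445`. -/

namespace BudgetMech

variable {n : ℕ}

/-! ### Consequences of submodularity -/

namespace Instance

variable (I : Instance n)

lemma marginal_le_single {i : Fin n} {S : Finset (Fin n)} (h : i ∉ S) :
    marginal I.value i S ≤ I.value {i} := by
  have := I.submodular ∅ S (empty_subset _) i h
  simpa [marginal, I.value_empty] using this

lemma value_union_le (A D : Finset (Fin n)) :
    I.value (A ∪ D) ≤ I.value A + ∑ i ∈ D \ A, marginal I.value i A := by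
  induction D using Finset.induction_on with
  | empty => simp
  | insert a D ha ih =>
    by_cases haA : a ∈ A
    · rw [union_insert, insert_eq_of_mem (mem_union_left _ haA), insert_sdiff_of_mem _ haA]
      exact ih
    · rw [union_insert, insert_sdiff_of_notMem _ haA, sum_insert (by simp [ha])]
      have := I.submodular A (A ∪ D) subset_union_left a (by simp [ha, haA])
      simp only [marginal] at *
      linarith

lemma value_union_sub_le {S U : Finset (Fin n)} (hSU : S ⊆ U) (D : Finset (Fin n))
    (hD : Disjoint D U) :
    I.value (U ∪ D) - I.value U ≤ I.value (S ∪ D) - I.value S := by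
  induction D using Finset.induction_on with
  | empty => simp
  | insert a D ha ih =>
    rw [disjoint_insert_left] at hD
    rw [union_insert, union_insert]
    have := I.submodular (S ∪ D) (U ∪ D) (union_subset_union_left hSU) a (by simp [ha, hD.1])
    have := ih hD.2
    simp only [marginal] at *
    linarith

lemma value_union_add_inter_le (A D : Finset (Fin n)) :
    I.value (A ∪ D) + I.value (A ∩ D) ≤ I.value A + I.value D := by
  have := I.value_union_sub_le (inter_subset_left : A ∩ D ⊆ A) (D \ A) sdiff_disjoint
  have h1 : A ∪ D \ A = A ∪ D := union_sdiff_self_eq_union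
  have h2 : A ∩ D ∪ D \ A = D := by
    ext x; simp only [mem_union, mem_inter, mem_sdiff]; tauto
  rw [h1, h2] at this
  linarith

lemma value_union_le_add (A D : Finset (Fin n)) : I.value (A ∪ D) ≤ I.value A + I.value D := by
  have := I.value_union_add_inter_le A D
  have := I.value_nonneg (A ∩ D)
  linarith

end Instance

/-! ### Analysis of posted prices -/

/-- What holds for the state of the posted-price mechanism after the agents of `L` arrived, if no
single agent is worth more than `m`. -/
structure PostedInvariant (I : Instance n) (t m : ℝ) (L : Finset (Fin n)) (st : State n) :
    Prop where
  sub : ∀ k, st.sol k ⊆ L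
  disj : ∀ k k', k ≠ k' → Disjoint (st.sol k) (st.sol k')
  rem_eq : ∀ k, t * (I.budget - st.rem k) = I.budget * I.value (st.sol k)
  cross : ∀ k k', k ≠ k' →
    ∑ x ∈ st.sol k', max (marginal I.value x (st.sol k)) 0 ≤ I.value (st.sol k')
  rejected : (∃ k, t - m < I.value (st.sol k)) ∨
    ∀ i ∈ L, (∀ k, i ∉ st.sol k) → ∀ k, I.budget * marginal I.value i (st.sol k) ≤ t * I.cost i

lemma marginal_le_better (I : Instance n) (st : State n) (i : Fin n) (k : Fin 2) :
    marginal I.value i (st.sol k) ≤ marginal I.value i (st.sol (better I st i)) := by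
  unfold better
  split_ifs with h
  · fin_cases k
    · exact le_rfl
    · exact h
  · fin_cases k
    · exact (not_le.mp h).le
    · exact le_rfl

lemma PostedInvariant.init (I : Instance n) (t m : ℝ) :
    PostedInvariant I t m ∅ (initState I) where
  sub := by simp [initState]
  disj := by simp [initState]
  rem_eq := by simp [initState, I.value_empty]
  cross := by simp [initState, I.value_empty]
  rejected := Or.inr (by simp)

/-- Hiring only enlarges a candidate, so marginals of agents outside it fall and the old bounds in
`cross` and `rejected` survive. The new term in `cross` is controlled by the choice of the better
candidate. The `max` with `0` in `cross` lets the sum be restricted to a subset later; it costs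
nothing, since a hired agent has a positive price and hence a positive marginal. -/
lemma PostedInvariant.step {I : Instance n} {t m : ℝ} (ht : 0 < t)
    (hm : ∀ i, I.value {i} ≤ m) {L : Finset (Fin n)} {st : State n}
    (h : PostedInvariant I t m L st) {i : Fin n} (hi : i ∉ L) :
    PostedInvariant I t m (insert i L) (step I t st i) := by
  have hB := I.budget_pos
  have hni : ∀ k, i ∉ st.sol k := fun k hk => hi (h.sub k hk)
  have hoff : t * offer I t st i =
      I.budget * marginal I.value i (st.sol (better I st i)) := by
    unfold offer; field_simp
  unfold BudgetMech.step
  simp only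
  split_ifs with hc
  · obtain ⟨hc1, hc2⟩ := hc
    set j := better I st i with hj
    have hpos : 0 < marginal I.value i (st.sol j) := by
      have h1 : 0 < offer I t st i := (I.cost_pos i).trans_le hc1
      have h2 : 0 < I.budget * marginal I.value i (st.sol j) := hoff ▸ mul_pos ht h1
      exact (mul_pos_iff_of_pos_left hB).mp h2
    have hins : I.value (insert i (st.sol j)) =
        I.value (st.sol j) + marginal I.value i (st.sol j) := by
      unfold marginal; ring
    have hmono : ∀ k, I.value (st.sol k) ≤
        I.value (Function.update st.sol j (insert i (st.sol j)) k) := by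
      intro k
      by_cases hk : k = j
      · subst hk; rw [Function.update_self]; linarith
      · rw [Function.update_of_ne hk]
    have hanti : ∀ k x, x ≠ i → x ∉ st.sol k →
        marginal I.value x (Function.update st.sol j (insert i (st.sol j)) k) ≤
          marginal I.value x (st.sol k) := by
      intro k x hx hxk
      by_cases hk : k = j
      · subst hk; rw [Function.update_self]
        exact I.submodular _ _ (subset_insert _ _) x (by simp [hx, hxk])
      · rw [Function.update_of_ne hk]
    refine ⟨?_, ?_, ?_, ?_, ?_⟩
    · intro k
      by_cases hk : k = j
      · subst hk; simp only [Function.update_self]; exact insert_subset_insert _ (h.sub _)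
      · simp only [Function.update_of_ne hk]; exact (h.sub k).trans (subset_insert _ _)
    · intro k k' hkk
      by_cases hk : k = j
      · subst hk
        simp only [Function.update_self, Function.update_of_ne hkk.symm]
        exact disjoint_insert_left.mpr ⟨hni _, h.disj _ _ hkk⟩
      · by_cases hk' : k' = j
        · subst hk'
          simp only [Function.update_self, Function.update_of_ne hk]
          exact disjoint_insert_right.mpr ⟨hni _, h.disj _ _ hkk⟩
        · simp only [Function.update_of_ne hk, Function.update_of_ne hk']
          exact h.disj _ _ hkk
    · intro k
      by_cases hk : k = j
      · subst hk
        simp only [Function.update_self]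
        rw [hins]
        have := h.rem_eq j
        linarith
      · simp only [Function.update_of_ne hk]; exact h.rem_eq k
    · intro k k' hkk
      have hold : ∑ x ∈ st.sol k',
          max (marginal I.value x (Function.update st.sol j (insert i (st.sol j)) k)) 0 ≤
            I.value (st.sol k') := by
        refine (sum_le_sum fun x hx => max_le_max_right 0 (hanti k x ?_ ?_)).trans
          (h.cross k k' hkk)
        · rintro rfl; exact hni _ hx
        · exact fun hxk => disjoint_left.mp (h.disj k k' hkk) hxk hx
      by_cases hk' : k' = j
      · subst hk'
        simp only [Function.update_self, sum_insert (hni _)]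
        rw [hins, add_comm (I.value _)]
        refine add_le_add (max_le ?_ hpos.le) hold
        rw [Function.update_of_ne hkk]
        exact marginal_le_better I st i k
      · simp only [Function.update_of_ne hk']
        exact hold
    · rcases h.rejected with ⟨k, hk⟩ | hr
      · exact Or.inl ⟨k, hk.trans_le (hmono k)⟩
      · right
        intro x hx hxn k
        have hxi : x ≠ i := by
          rintro rfl
          apply hxn j
          simp
        have hxs : ∀ k, x ∉ st.sol k := by
          intro k hk
          apply hxn k
          by_cases hkj : k = j
          · subst hkj; simp [hk]
          · simpa [Function.update_of_ne hkj] using hk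
        have h1 := hr x ((mem_insert.mp hx).resolve_left hxi) hxs k
        have h2 := mul_le_mul_of_nonneg_left (hanti k x hxi (hxs k)) hB.le
        exact h2.trans h1
  · refine ⟨fun k => (h.sub k).trans (subset_insert _ _), h.disj, h.rem_eq, h.cross, ?_⟩
    rcases h.rejected with hk | hr
    · exact Or.inl hk
    by_cases hc1 : I.cost i ≤ offer I t st i
    · have hc2 : st.rem (better I st i) < offer I t st i := by
        by_contra hcon
        exact hc ⟨hc1, by linarith⟩
      -- Only the budget stopped `i`: spending plus her price exceeds `B`, so the value of the
      -- candidate plus her marginal exceeds `t`, and the marginal is at most `m`.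
      left
      refine ⟨better I st i, ?_⟩
      have h1 := h.rem_eq (better I st i)
      have h2 := (I.marginal_le_single (hni (better I st i))).trans (hm i)
      have h3 := mul_lt_mul_of_pos_left hc2 ht
      have h4 : I.budget * (t - m) < I.budget * I.value (st.sol (better I st i)) := by
        have := mul_le_mul_of_nonneg_left h2 hB.le
        nlinarith
      exact lt_of_mul_lt_mul_left h4 hB.le
    · right
      intro x hx hxn k
      rcases mem_insert.mp hx with rfl | hxL
      · have h1 := mul_le_mul_of_nonneg_left (marginal_le_better I st x k) hB.le
        have h2 := mul_lt_mul_of_pos_left (not_le.mp hc1) ht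
        linarith
      · exact hr x hxL hxn k

lemma PostedInvariant.foldl {I : Instance n} {t m : ℝ} (ht : 0 < t)
    (hm : ∀ i, I.value {i} ≤ m) (l : List (Fin n)) :
    ∀ (L : Finset (Fin n)) (st : State n), PostedInvariant I t m L st → l.Nodup →
      (∀ i ∈ l, i ∉ L) →
      PostedInvariant I t m (L ∪ l.toFinset) (l.foldl (BudgetMech.step I t) st) := by
  induction l with
  | nil => intro L st h _ _; simpa using h
  | cons a l ih =>
    intro L st h hnd hL
    rw [List.nodup_cons] at hnd
    have := ih (insert a L) _ (h.step ht hm (hL a (by simp))) hnd.2 (by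
      intro i hi
      rw [mem_insert, not_or]
      exact ⟨fun e => hnd.1 (e ▸ hi), hL i (by simp [hi])⟩)
    rw [List.foldl_cons]
    convert this using 1
    ext x
    simp only [mem_union, List.toFinset_cons, mem_insert]
    tauto

/-- Bounding each `v(S_k ∪ O)` from above and adding the two bounds suffices, because disjointness
of the candidates makes `O` the intersection of the two unions. -/
lemma PostedInvariant.value_le {I : Instance n} {t m : ℝ} (ht : 0 < t) {L : Finset (Fin n)}
    {st : State n} (h : PostedInvariant I t m L st) {O : Finset (Fin n)} (hO : Feasible I L O)
    (hbig : ∀ k, I.value (st.sol k) ≤ t - m) :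
    I.value O ≤ 2 * (I.value (st.sol 0) + I.value (st.sol 1)) + 2 * t := by
  have hB := I.budget_pos
  have hr := h.rejected.resolve_left (by rintro ⟨k, hk⟩; exact (hbig k).not_gt hk)
  have key : ∀ k k', k ≠ k' → (∀ i, i ∉ st.sol k → i ∉ st.sol k' → ∀ k, i ∉ st.sol k) →
      I.value (st.sol k ∪ O) ≤ I.value (st.sol k) + I.value (st.sol k') + t := by
    intro k k' hkk hall
    refine (I.value_union_le _ _).trans ?_
    rw [add_assoc]
    refine add_le_add_right ?_ _
    -- Agents of `O` in the other candidate are paid for by `cross`; the remaining ones were refused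
    -- and are paid for by their costs, which total at most the budget.
    rw [← sum_filter_add_sum_filter_not (O \ st.sol k) (· ∈ st.sol k')]
    refine add_le_add ?_ ?_
    · refine le_trans ?_ (h.cross k k' hkk)
      refine (sum_le_sum fun x _ => le_max_left _ 0).trans ?_
      refine sum_le_sum_of_subset_of_nonneg ?_ fun _ _ _ => le_max_right _ _
      intro x hx
      exact (mem_filter.mp hx).2
    · have h1 : ∀ x ∈ (O \ st.sol k).filter (· ∉ st.sol k'),
          marginal I.value x (st.sol k) ≤ t / I.budget * I.cost x := by
        intro x hx
        rw [mem_filter, mem_sdiff] at hx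
        have := hr x (hO.1 hx.1.1) (hall x hx.1.2 hx.2) k
        rw [div_mul_eq_mul_div, le_div_iff₀ hB]
        linarith
      refine (sum_le_sum h1).trans ?_
      rw [← mul_sum]
      have h2 : ∑ x ∈ (O \ st.sol k).filter (· ∉ st.sol k'), I.cost x ≤ I.budget := by
        refine le_trans ?_ hO.2
        refine sum_le_sum_of_subset_of_nonneg ?_ fun x _ _ => (I.cost_pos x).le
        exact (filter_subset _ _).trans sdiff_subset
      calc t / I.budget * _ ≤ t / I.budget * I.budget :=
            mul_le_mul_of_nonneg_left h2 (by positivity)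
        _ = t := by field_simp
  have h01 := key 0 1 (by decide) (fun i h0 h1 k => by fin_cases k <;> assumption)
  have h10 := key 1 0 (by decide) (fun i h0 h1 k => by fin_cases k <;> assumption)
  have hsub := I.value_union_add_inter_le (st.sol 0 ∪ O) (st.sol 1 ∪ O)
  have hint : (st.sol 0 ∪ O) ∩ (st.sol 1 ∪ O) = O := by
    rw [← inter_union_distrib_right, disjoint_iff_inter_eq_empty.mp (h.disj 0 1 (by decide)),
      empty_union]
  rw [hint] at hsub
  have := I.value_nonneg (st.sol 0 ∪ O ∪ (st.sol 1 ∪ O))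
  linarith

/-- The guarantee of the posted-price mechanism. -/
lemma postedPrice_value {I : Instance n} {t m : ℝ} (ht : 0 < t) (hm : ∀ i, I.value {i} ≤ m)
    {l : List (Fin n)} (hl : l.Nodup) {O : Finset (Fin n)} (hO : Feasible I l.toFinset O) {x : ℝ}
    (hx1 : 2 * x ≤ t - m) (hx2 : 4 * x + 2 * t ≤ I.value O) :
    2 * x ≤ ∑ j, I.value (postedPrice I t l j).hired := by
  have h := PostedInvariant.foldl ht hm l ∅ _ (PostedInvariant.init I t m) hl (by simp)
  rw [empty_union] at h
  rw [Fin.sum_univ_two]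
  simp only [postedPrice]
  have h0 := I.value_nonneg ((l.foldl (step I t) (initState I)).sol 0)
  have h1 := I.value_nonneg ((l.foldl (step I t) (initState I)).sol 1)
  by_cases hbig : ∀ k, I.value ((l.foldl (step I t) (initState I)).sol k) ≤ t - m
  · have := h.value_le ht hO hbig
    linarith
  · push Not at hbig
    obtain ⟨k, hk⟩ := hbig
    fin_cases k <;> simp only [Fin.zero_eta, Fin.mk_one] at hk <;> linarith

lemma sum_postedPrice_nonneg (I : Instance n) (t : ℝ) (l : List (Fin n)) :
    0 ≤ ∑ j, I.value (postedPrice I t l j).hired :=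
  sum_nonneg fun _ _ => I.value_nonneg _

/-! ### A variance bound for monotone submodular functions of a random set -/

/-- In probabilistic terms, `Var f ≤ (m/2) (E f - f ∅)` for a uniformly random subset of `W`.
Averaging over the presence of one element `a` gives `g`, and `Var f = Var g + E[D²]/4` with `D` the
marginal of `a`. Here `D² ≤ m D` and, by submodularity, `E D ≤ D ∅`; the resulting `m D(∅)/4` is
exactly what `g ∅ = f ∅ + D(∅)/2` releases in the induction hypothesis. -/
lemma sum_sq_powerset_le {α : Type*} [DecidableEq α] {m : ℝ} (W : Finset α) :
    ∀ f : Finset α → ℝ,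
      (∀ S U : Finset α, S ⊆ U → U ⊆ W → ∀ i ∈ W, i ∉ U →
        f (insert i U) - f U ≤ f (insert i S) - f S) →
      (∀ S ⊆ W, ∀ i ∈ W, i ∉ S → 0 ≤ f (insert i S) - f S ∧ f (insert i S) - f S ≤ m) →
      2 ^ #W * ∑ S ∈ W.powerset, f S ^ 2 - (∑ S ∈ W.powerset, f S) ^ 2 ≤
        m / 2 * 2 ^ #W * (∑ S ∈ W.powerset, f S - 2 ^ #W * f ∅) := by
  induction W using Finset.induction_on with
  | empty => intro f _ _; simp
  | insert a W ha ih =>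
    intro f hf hm
    set g : Finset α → ℝ := fun S => (f S + f (insert a S)) / 2 with hg
    set D : Finset α → ℝ := fun S => f (insert a S) - f S with hD
    have hsub : ∀ {S}, S ⊆ W → S ⊆ insert a W := fun h => h.trans (subset_insert _ _)
    have hnot : ∀ {S}, S ⊆ W → a ∉ S := fun h h' => ha (h h')
    have hna : ∀ {i}, i ∈ W → i ≠ a := fun h e => ha (e ▸ h)
    have hG := ih g ?_ ?_
    rotate_left
    · intro S U hSU hUW i hi hiU
      have h1 := hf S U hSU (hsub hUW) i (mem_insert_of_mem hi) hiU
      have h2 := hf (insert a S) (insert a U) (insert_subset_insert _ hSU)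
        (insert_subset_insert _ hUW) i (mem_insert_of_mem hi) (by simp [hiU, hna hi])
      simp only [hg]
      rw [insert_comm a i, insert_comm a i]
      linarith
    · intro S hS i hi hiS
      have h1 := hm S (hsub hS) i (mem_insert_of_mem hi) hiS
      have h2 := hm (insert a S) (insert_subset_insert _ hS) i (mem_insert_of_mem hi)
        (by simp [hiS, hna hi])
      simp only [hg]
      rw [insert_comm a i]
      constructor <;> linarith [h1.1, h1.2, h2.1, h2.2]
    have e1 : ∑ S ∈ (insert a W).powerset, f S = 2 * ∑ S ∈ W.powerset, g S := by
      rw [sum_powerset_insert ha, ← sum_add_distrib, mul_sum]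
      refine sum_congr rfl fun S _ => ?_
      simp only [hg]; ring
    have e2 : ∑ S ∈ (insert a W).powerset, f S ^ 2 =
        2 * ∑ S ∈ W.powerset, g S ^ 2 + 1 / 2 * ∑ S ∈ W.powerset, D S ^ 2 := by
      rw [sum_powerset_insert ha, ← sum_add_distrib, mul_sum, mul_sum, ← sum_add_distrib]
      refine sum_congr rfl fun S _ => ?_
      simp only [hg, hD]; ring
    have e3 : ∑ S ∈ W.powerset, D S ^ 2 ≤ m * ∑ S ∈ W.powerset, D S := by
      rw [mul_sum]
      refine sum_le_sum fun S hS => ?_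
      rw [mem_powerset] at hS
      have := hm S (hsub hS) a (mem_insert_self _ _) (hnot hS)
      rw [sq]
      exact mul_le_mul_of_nonneg_right this.2 this.1
    have e4 : ∑ S ∈ W.powerset, D S ≤ 2 ^ #W * D ∅ := by
      have : ∀ S ∈ W.powerset, D S ≤ D ∅ := by
        intro S hS
        rw [mem_powerset] at hS
        exact hf ∅ S (empty_subset _) (hsub hS) a (mem_insert_self _ _) (hnot hS)
      have := sum_le_card_nsmul _ _ _ this
      rwa [card_powerset, nsmul_eq_mul, Nat.cast_pow, Nat.cast_ofNat] at this
    have hm0 : 0 ≤ m := by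
      have := hm ∅ (empty_subset _) a (mem_insert_self _ _) (by simp)
      linarith [this.1, this.2]
    have e5 : g ∅ = f ∅ + D ∅ / 2 := by simp only [hg, hD]; ring
    rw [e1, e2, card_insert_of_notMem ha, pow_succ]
    rw [e5] at hG
    have hN : (0 : ℝ) < 2 ^ #W := by positivity
    generalize (2 : ℝ) ^ #W = N at *
    have e6 := mul_le_mul_of_nonneg_left e3 hN.le
    have e7 := mul_le_mul_of_nonneg_left e4 (mul_nonneg hm0 hN.le)
    nlinarith

/-- Chebyshev's inequality for a monotone submodular function of a uniformly random set. -/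
lemma card_filter_lt_mul_le {α : Type*} [DecidableEq α] [Fintype α] {m V : ℝ} (hV : 0 < V)
    (f : Finset α → ℝ) (f_empty : f ∅ = 0)
    (hf : ∀ S U : Finset α, S ⊆ U → ∀ i, i ∉ U → f (insert i U) - f U ≤ f (insert i S) - f S)
    (hm : ∀ S : Finset α, ∀ i, i ∉ S → 0 ≤ f (insert i S) - f S ∧ f (insert i S) - f S ≤ m)
    (hc : ∀ S, V ≤ f S + f Sᶜ) :
    (#{S : Finset α | f S < 2 / 5 * V} : ℝ) * V ≤ 25 * m * 2 ^ Fintype.card α := by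
  have hvar := sum_sq_powerset_le (m := m) (univ : Finset α) f
    (fun S U h _ i _ hi => hf S U h i hi) (fun S _ i _ hi => hm S i hi)
  rw [powerset_univ, f_empty, card_univ] at hvar
  have hcardN : ((univ : Finset (Finset α)).card : ℝ) = 2 ^ Fintype.card α := by
    rw [card_univ, Fintype.card_finset]; push_cast; rfl
  have hcompl : ∑ S : Finset α, f Sᶜ = ∑ S, f S :=
    Fintype.sum_equiv ⟨compl, compl, compl_compl, compl_compl⟩ _ _ fun _ => rfl
  have hmean : 2 ^ Fintype.card α * V ≤ 2 * ∑ S, f S := by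
    have : ∑ _S : Finset α, V ≤ ∑ S, (f S + f Sᶜ) := sum_le_sum fun S _ => hc S
    rw [sum_add_distrib, hcompl, sum_const, nsmul_eq_mul, hcardN] at this
    linarith
  have hN : (0 : ℝ) < 2 ^ Fintype.card α := by positivity
  set N : ℝ := 2 ^ Fintype.card α with hNdef
  set μ : ℝ := (∑ S, f S) / N with hμ
  have hsum : ∑ S, f S = N * μ := by rw [hμ]; field_simp
  have hμV : V / 2 ≤ μ := by rw [hsum] at hmean; nlinarith
  rw [hsum] at hvar
  have hdev : ∑ S, (f S - μ) ^ 2 = ∑ S, f S ^ 2 - N * μ ^ 2 := by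
    have : ∀ S, (f S - μ) ^ 2 = f S ^ 2 - 2 * μ * f S + μ ^ 2 := fun S => by ring
    simp_rw [this]
    rw [sum_add_distrib, sum_sub_distrib, ← mul_sum, hsum, sum_const, nsmul_eq_mul, hcardN]
    ring
  have hle : ∑ S, (f S - μ) ^ 2 ≤ m / 2 * N * μ := by
    rw [hdev]
    have : N * (∑ S, f S ^ 2 - N * μ ^ 2) ≤ N * (m / 2 * N * μ) := by nlinarith
    exact le_of_mul_le_mul_left this hN
  have hbad : (#{S : Finset α | f S < 2 / 5 * V} : ℝ) * (μ - 2 / 5 * V) ^ 2 ≤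
      ∑ S, (f S - μ) ^ 2 := by
    rw [← nsmul_eq_mul]
    refine (card_nsmul_le_sum _ (fun S => (f S - μ) ^ 2) _ ?_).trans
      (sum_le_sum_of_subset_of_nonneg (subset_univ _) fun _ _ _ => sq_nonneg _)
    intro S hS
    have := (mem_filter.mp hS).2
    nlinarith
  set b : ℝ := (#{S : Finset α | f S < 2 / 5 * V} : ℝ)
  have hb : 0 ≤ b := Nat.cast_nonneg _
  -- Equality holds at `μ = V/2`, the smallest mean allowed; this fixes the constant `25 = 50/2`.
  have hquad : μ * V ≤ 50 * (μ - 2 / 5 * V) ^ 2 := by nlinarith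
  have h1 : μ * (b * V) ≤ μ * (25 * m * N) := by
    have := mul_le_mul_of_nonneg_left hquad hb
    nlinarith
  exact le_of_mul_le_mul_left h1 (by linarith)

/-! ### Uniformly random permutations -/

lemma exists_perm_map_eq {α : Type*} [DecidableEq α] [Fintype α] {A S : Finset α}
    (h : #A = #S) : ∃ σ : Equiv.Perm α, A.map σ.toEmbedding = S := by
  have e : {x // x ∈ A} ≃ {x // x ∈ S} := A.equivOfCardEq h
  refine ⟨e.extendSubtype, ?_⟩
  refine eq_of_subset_of_card_le ?_ (by rw [card_map, h])
  intro x hx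
  obtain ⟨y, hy, rfl⟩ := mem_map.mp hx
  exact e.extendSubtype_mem y hy

/-- The image of a fixed `k`-set under a uniformly random permutation is a uniformly random
`k`-set. -/
lemma choose_mul_sum_perm {α : Type*} [DecidableEq α] [Fintype α] (G : Finset α → ℝ)
    (A : Finset α) :
    ((Fintype.card α).choose #A : ℝ) * ∑ π : Equiv.Perm α, G (A.map π.toEmbedding) =
      (Fintype.card α).factorial * ∑ S ∈ powersetCard #A univ, G S := by
  -- Composing with a permutation that carries `S` to `A` shows that the sum over `π` depends on the
  -- cardinality only. Summing over all `S` and exchanging the sums, each `π` merely permutes the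
  -- `k`-sets.
  have h1 : ∀ S ∈ powersetCard #A (univ : Finset α),
      ∑ π : Equiv.Perm α, G (A.map π.toEmbedding) =
        ∑ π : Equiv.Perm α, G (S.map π.toEmbedding) := by
    intro S hS
    obtain ⟨σ, hσ⟩ := exists_perm_map_eq (mem_powersetCard.mp hS).2.symm
    refine (Fintype.sum_equiv (Equiv.mulRight σ) _ _ fun π => ?_).symm
    rw [← hσ, map_map]
    rfl
  have h2 : ∀ π : Equiv.Perm α, ∑ S ∈ powersetCard #A univ, G (S.map π.toEmbedding) =
      ∑ S ∈ powersetCard #A univ, G S := by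
    intro π
    refine sum_bij' (fun S _ => S.map π.toEmbedding) (fun S _ => S.map π.symm.toEmbedding)
      ?_ ?_ ?_ ?_ ?_
    · intro S hS; simpa [mem_powersetCard] using hS
    · intro S hS; simpa [mem_powersetCard] using hS
    · intro S _; ext; simp
    · intro S _; ext; simp
    · intro S _; rfl
  have h3 := sum_congr rfl h1
  rw [sum_const, card_powersetCard, card_univ, nsmul_eq_mul, sum_comm] at h3
  rw [h3, sum_congr rfl fun π _ => h2 π, sum_const, card_univ, Fintype.card_perm, nsmul_eq_mul]

lemma exists_perm_apply_pair {α : Type*} [DecidableEq α] {s b x y : α} (hsb : s ≠ b)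
    (hxy : x ≠ y) : ∃ σ : Equiv.Perm α, σ s = x ∧ σ b = y := by
  refine ⟨Equiv.swap (Equiv.swap s x b) y * Equiv.swap s x, ?_, ?_⟩
  · rw [Equiv.Perm.mul_apply, Equiv.swap_apply_left]
    refine Equiv.swap_apply_of_ne_of_ne ?_ hxy
    intro h
    apply hsb
    have := congrArg (Equiv.swap s x) h
    simpa using this
  · simp

/-- The number of permutations that move a `k`-set onto a set with `s` and without `b`. -/
lemma card_perm_mem_notMem {α : Type*} [DecidableEq α] [Fintype α] (A : Finset α) {s b : α}
    (hsb : s ≠ b) :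
    (Fintype.card α * (Fintype.card α - 1)) *
        #{π : Equiv.Perm α | s ∈ A.map π.toEmbedding ∧ b ∉ A.map π.toEmbedding} =
      (Fintype.card α).factorial * (#A * (Fintype.card α - #A)) := by
  -- Double counting: by 2-transitivity all ordered pairs of distinct points give the same count,
  -- while for fixed `π` the separated pairs form the product of the image and its complement.
  have h1 : ∀ xy ∈ (univ : Finset α).offDiag,
      #{π : Equiv.Perm α | s ∈ A.map π.toEmbedding ∧ b ∉ A.map π.toEmbedding} =
        #{π : Equiv.Perm α | xy.1 ∈ A.map π.toEmbedding ∧ xy.2 ∉ A.map π.toEmbedding} := by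
    intro xy hxy
    obtain ⟨σ, hs, hb⟩ := exists_perm_apply_pair hsb (mem_offDiag.mp hxy).2.2
    refine card_bij' (fun π _ => σ * π) (fun π _ => σ⁻¹ * π) ?_ ?_ ?_ ?_
    · intro π hπ
      simp only [mem_filter, mem_univ, true_and, mem_map_equiv] at hπ ⊢
      rw [← hs, ← hb]
      simpa [Equiv.Perm.mul_def] using hπ
    · intro π hπ
      simp only [mem_filter, mem_univ, true_and, mem_map_equiv] at hπ ⊢
      rw [← hs, ← hb] at hπ
      have hinv : (σ⁻¹).symm = σ := rfl
      simpa [Equiv.Perm.mul_def, hinv] using hπ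
    · intro π _; simp
    · intro π _; simp
  have h2 : ∀ π : Equiv.Perm α,
      #{xy ∈ (univ : Finset α).offDiag | xy.1 ∈ A.map π.toEmbedding ∧
        xy.2 ∉ A.map π.toEmbedding} = #A * (Fintype.card α - #A) := by
    intro π
    have : {xy ∈ (univ : Finset α).offDiag | xy.1 ∈ A.map π.toEmbedding ∧
        xy.2 ∉ A.map π.toEmbedding} = A.map π.toEmbedding ×ˢ (A.map π.toEmbedding)ᶜ := by
      ext ⟨x, y⟩
      simp only [mem_filter, mem_offDiag, mem_univ, true_and, mem_product, mem_compl]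
      refine ⟨fun h => h.2, fun h => ⟨?_, h⟩⟩
      rintro rfl
      exact h.2 h.1
    rw [this, card_product, card_compl, card_map]
  have h3 := sum_congr rfl h1
  rw [sum_const, offDiag_card, card_univ, smul_eq_mul] at h3
  rw [Nat.mul_sub_one, h3]
  simp_rw [card_filter]
  rw [sum_comm]
  simp_rw [← card_filter, h2]
  rw [sum_const, card_univ, Fintype.card_perm, smul_eq_mul]

/-! ### Arrivals -/

/-- The first `k` slots. -/
def slots (n k : ℕ) : Finset (Fin n) := ((List.finRange n).take k).toFinset

lemma card_slots {k : ℕ} (hk : k ≤ n) : #(slots n k) = k := by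
  rw [slots, List.toFinset_card_of_nodup ((List.nodup_finRange n).sublist (List.take_sublist _ _))]
  simp [hk]

lemma nodup_arrivals (π : Equiv.Perm (Fin n)) : (arrivals π).Nodup :=
  (List.nodup_finRange n).map π.injective

lemma mem_arrivals (π : Equiv.Perm (Fin n)) (i : Fin n) : i ∈ arrivals π := by
  simpa [arrivals] using π.surjective i

lemma toFinset_take_arrivals (π : Equiv.Perm (Fin n)) (k : ℕ) :
    ((arrivals π).take k).toFinset = (slots n k).map π.toEmbedding := by
  ext x
  simp only [arrivals, slots, mem_map, List.mem_toFinset, Equiv.coe_toEmbedding]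
  rw [← List.map_take, List.mem_map]

lemma mem_drop_arrivals (π : Equiv.Perm (Fin n)) (k : ℕ) (i : Fin n) :
    i ∈ (arrivals π).drop k ↔ i ∉ (arrivals π).take k := by
  have h := mem_arrivals π i
  have hn := nodup_arrivals π
  rw [← List.take_append_drop k (arrivals π)] at h hn
  rw [List.mem_append] at h
  exact ⟨fun hd ht => (List.disjoint_of_nodup_append hn) ht hd, h.resolve_left⟩

lemma toFinset_drop_arrivals (π : Equiv.Perm (Fin n)) (k : ℕ) :
    ((arrivals π).drop k).toFinset = ((arrivals π).take k).toFinsetᶜ := by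
  ext i
  simp only [List.mem_toFinset, mem_compl, mem_drop_arrivals]

/-- The first `ξ` agents, for binomial `ξ`, form a uniformly random set. -/
lemma average_take_arrivals (G : Finset (Fin n) → ℝ) :
    1 / (n.factorial : ℝ) * ∑ π : Equiv.Perm (Fin n), ∑ ξ : Fin (n + 1),
      ((n.choose ξ : ℝ) * (1 / 2) ^ n) * G ((arrivals π).take ξ).toFinset =
    (1 / 2) ^ n * ∑ S, G S := by
  rw [sum_comm]
  have h : ∀ ξ : Fin (n + 1), ∑ π : Equiv.Perm (Fin n),
      ((n.choose ξ : ℝ) * (1 / 2) ^ n) * G ((arrivals π).take ξ).toFinset =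
      (n.factorial : ℝ) * ((1 / 2) ^ n * ∑ S ∈ powersetCard ξ univ, G S) := by
    intro ξ
    -- The binomial coefficient in the law of `ξ` cancels the number of `ξ`-sets, so every set gets
    -- weight `2⁻ⁿ`.
    have h1 := choose_mul_sum_perm G (slots n ξ)
    rw [card_slots (Nat.lt_succ_iff.mp ξ.2), Fintype.card_fin] at h1
    simp_rw [toFinset_take_arrivals]
    rw [← mul_sum]
    linear_combination (1 / 2) ^ n * h1
  rw [sum_congr rfl fun ξ _ => h ξ, ← mul_sum, ← mul_sum, ← mul_assoc,
    one_div_mul_cancel (by positivity), one_mul,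
    Fin.sum_univ_eq_sum_range (fun k => ∑ S ∈ powersetCard k univ, G S)]
  have h2 := sum_powerset (univ : Finset (Fin n)) G
  rw [powerset_univ, card_univ, Fintype.card_fin] at h2
  rw [h2]

lemma find?_eq_some_of_unique {α : Type*} {p : α → Bool} {l : List α} {b : α} (hb : b ∈ l)
    (hp : p b) (h : ∀ x ∈ l, p x → x = b) : l.find? p = some b := by
  cases hf : l.find? p with
  | none => exact absurd hp (List.find?_eq_none.mp hf b hb)
  | some x => rw [h x (List.mem_of_find?_eq_some hf) (List.find?_some hf)]

/-! ### Dynkin's algorithm -/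

lemma floor_div_exp_zero {k : ℕ} (hk : k ≤ 2) : ⌊(k : ℝ) / Real.exp 1⌋₊ = 0 := by
  rw [Nat.floor_eq_zero, div_lt_one (Real.exp_pos 1)]
  have := Real.exp_one_gt_d9
  have : (k : ℝ) ≤ 2 := by exact_mod_cast hk
  linarith

lemma le_five_mul_floor {k : ℕ} (hk : 3 ≤ k) :
    k * (k - 1) ≤ 5 * (⌊(k : ℝ) / Real.exp 1⌋₊ * (k - ⌊(k : ℝ) / Real.exp 1⌋₊)) := by
  have he1 := Real.exp_one_gt_d9
  have he2 := Real.exp_one_lt_d9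
  have h1 := Nat.floor_le (a := (k : ℝ) / Real.exp 1) (by positivity)
  have h2 := Nat.lt_floor_add_one ((k : ℝ) / Real.exp 1)
  set r := ⌊(k : ℝ) / Real.exp 1⌋₊
  have hk0 : (0 : ℝ) < k := by positivity
  rw [le_div_iff₀ (Real.exp_pos 1)] at h1
  rw [div_lt_iff₀ (Real.exp_pos 1)] at h2
  have h3 : 10000 * (r : ℝ) ≤ 3679 * k := by
    have : (r : ℝ) * 2.7182818283 ≤ k := h1.trans' (by gcongr)
    linarith
  have h4 : 3678 * (k : ℝ) < 10000 * (r + 1) := by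
    have : (k : ℝ) < (r + 1) * 2.7182818286 := h2.trans_le (by gcongr)
    linarith
  have h3' : 10000 * r ≤ 3679 * k := by exact_mod_cast h3
  have h4' : 3678 * k < 10000 * (r + 1) := by exact_mod_cast h4
  clear_value r
  by_cases h7 : k < 7
  · interval_cases k
    · obtain rfl : r = 1 := by omega
      norm_num
    · obtain rfl : r = 1 := by omega
      norm_num
    · obtain rfl : r = 1 := by omega
      norm_num
    · obtain rfl : r = 2 := by omega
      norm_num
  · have h7' : (7 : ℝ) ≤ k := by exact_mod_cast not_lt.mp h7
    have hrk : r ≤ k := by omega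
    have key : (k : ℝ) * (k - 1) ≤ 5 * (r * (k - r)) := by
      -- Both `r` and `k - r` are at least `A = 0.3678 k - 1`, whence `r (k - r) ≥ A (k - A)`. The
      -- resulting quadratic inequality in `k` holds from `k = 7` on, hence the separate small
      -- cases.
      have h5 : 0 ≤ ((r : ℝ) - (3678 / 10000 * k - 1)) * (k - r - (3678 / 10000 * k - 1)) :=
        mul_nonneg (by linarith) (by linarith)
      nlinarith
    rw [← Nat.cast_le (α := ℝ)]
    push_cast [Nat.cast_sub hrk, Nat.cast_sub (by omega : 1 ≤ k)]
    exact key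

/-- `AtMost` is the lexicographic order on pairs of value and name. -/
lemma exists_forall_atMost (I : Instance n) {T : Finset (Fin n)} (hT : T.Nonempty) :
    ∃ b ∈ T, ∀ i ∈ T, AtMost I i b := by
  obtain ⟨b, hb, h⟩ := T.exists_max_image (fun i => toLex (I.value {i}, i)) hT
  exact ⟨b, hb, fun i hi => Prod.Lex.toLex_le_toLex.mp (h i hi)⟩

lemma AtMost.le {I : Instance n} {i j : Fin n} (h : AtMost I i j) : I.value {i} ≤ I.value {j} := by
  rcases h with h | h
  exacts [h.le, h.1.le]

lemma AtMost.antisymm {I : Instance n} {i j : Fin n} (h : AtMost I i j) (h' : AtMost I j i) :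
    i = j := by
  rcases h with h | h <;> rcases h' with h' | h'
  · exact absurd h h'.not_gt
  · exact absurd h h'.1.not_gt
  · exact absurd h' h.1.not_gt
  · exact le_antisymm h.2 h'.2

/-- Once the second best agent has been observed, only the best one can pass the test. This event
alone has probability at least `1/5` for `n ≥ 3`, so the sharper `1/e` analysis is not needed. -/
lemma hired_dynkin_of_second_observed {I : Instance n} {s b : Fin n} (hb : ∀ i, AtMost I i b)
    (hs : ∀ i, i ≠ b → AtMost I i s) {π : Equiv.Perm (Fin n)}
    (hsπ : s ∈ (arrivals π).take ⌊(n : ℝ) / Real.exp 1⌋₊)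
    (hbπ : b ∉ (arrivals π).take ⌊(n : ℝ) / Real.exp 1⌋₊) : (dynkin I π).hired = {b} := by
  unfold dynkin
  simp only
  rw [find?_eq_some_of_unique (b := b)]
  · rfl
  · exact (mem_drop_arrivals _ _ _).mpr hbπ
  · simpa using fun i _ => hb i
  · intro x hx hp
    by_contra hxb
    have h1 : AtMost I s x := by
      simp only [decide_eq_true_eq] at hp
      exact hp s hsπ
    have h2 := h1.antisymm (hs x hxb)
    exact (mem_drop_arrivals _ _ _).mp hx (h2 ▸ hsπ)

lemma hired_dynkin_of_floor_eq_zero {k : ℕ} {I : Instance (k + 1)}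
    (hr : ⌊((k + 1 : ℕ) : ℝ) / Real.exp 1⌋₊ = 0) (π : Equiv.Perm (Fin (k + 1))) :
    (dynkin I π).hired = {π 0} := by
  unfold dynkin
  simp only
  rw [hr]
  simp [arrivals, List.finRange_succ, hireOne]

/-- Dynkin's algorithm hires the best agent with probability at least `1/5`. -/
lemma le_sum_dynkin (I : Instance n) {b : Fin n} (hb : ∀ i, AtMost I i b) :
    n.factorial * I.value {b} ≤ 5 * ∑ π, I.value (dynkin I π).hired := by
  have hcount : ∀ Q : Equiv.Perm (Fin n) → Prop, ∀ [DecidablePred Q],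
      (∀ π, Q π → (dynkin I π).hired = {b}) → n.factorial ≤ 5 * #{π | Q π} →
      n.factorial * I.value {b} ≤ 5 * ∑ π, I.value (dynkin I π).hired := by
    intro Q _ hQ hc
    have h1 : (#{π | Q π} : ℝ) * I.value {b} ≤ ∑ π, I.value (dynkin I π).hired := by
      rw [← nsmul_eq_mul]
      refine (card_nsmul_le_sum _ (fun π => I.value (dynkin I π).hired) _ ?_).trans
        (sum_le_sum_of_subset_of_nonneg (subset_univ _) fun _ _ _ => I.value_nonneg _)
      intro π hπ
      rw [hQ π (mem_filter.mp hπ).2]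
    have h2 : (n.factorial : ℝ) ≤ 5 * #{π | Q π} := by exact_mod_cast hc
    have := mul_le_mul_of_nonneg_right h2 (I.value_nonneg {b})
    linarith
  have hn0 : n ≠ 0 := by rintro rfl; exact b.elim0
  -- For `n ≤ 2` nobody is observed and the first arrival is hired; she is the best with probability
  -- at least `1/2`.
  obtain rfl | rfl | hn : n = 1 ∨ n = 2 ∨ 3 ≤ n := by omega
  · refine hcount (fun π => π 0 = b) ?_ ?_
    · intro π hπ
      rw [hired_dynkin_of_floor_eq_zero (floor_div_exp_zero (by norm_num)), hπ]
    · clear hcount hb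
      revert b; decide
  · refine hcount (fun π => π 0 = b) ?_ ?_
    · intro π hπ
      rw [hired_dynkin_of_floor_eq_zero (floor_div_exp_zero (by norm_num)), hπ]
    · clear hcount hb
      revert b; decide
  · have : Nontrivial (Fin n) := Fin.nontrivial_iff_two_le.mpr (by omega)
    obtain ⟨c, hc⟩ := exists_ne b
    obtain ⟨s, hsb, hs⟩ := exists_forall_atMost I (T := univ.erase b) ⟨c, by simp [hc]⟩
    have hsb : s ≠ b := (mem_erase.mp hsb).1
    set r := ⌊(n : ℝ) / Real.exp 1⌋₊ with hr
    refine hcount (fun π => s ∈ (slots n r).map π.toEmbedding ∧ b ∉ (slots n r).map π.toEmbedding)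
      ?_ ?_
    · rintro π ⟨h1, h2⟩
      rw [← toFinset_take_arrivals, List.mem_toFinset] at h1 h2
      exact hired_dynkin_of_second_observed hb (fun i hi => hs i (by simp [hi])) h1 h2
    · have h1 := card_perm_mem_notMem (slots n r) hsb
      have hrn : r ≤ n := by
        refine Nat.floor_le_of_le (div_le_self (by positivity) ?_)
        exact Real.one_le_exp (by norm_num)
      rw [card_slots hrn, Fintype.card_fin] at h1
      have h2 := le_five_mul_floor hn
      rw [← hr] at h2
      have h3 : 0 < n * (n - 1) := Nat.mul_pos (by omega) (by omega)
      refine Nat.le_of_mul_le_mul_left ?_ h3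
      calc n * (n - 1) * n.factorial ≤ 5 * (r * (n - r)) * n.factorial :=
            Nat.mul_le_mul_right _ h2
        _ = 5 * (n.factorial * (r * (n - r))) := by ring
        _ = n * (n - 1) * (5 * _) := by rw [← h1]; ring

/-! ### Expectations -/

lemma sum_binomial (n : ℕ) : ∑ ξ : Fin (n + 1), (n.choose ξ : ℝ) * (1 / 2) ^ n = 1 := by
  rw [← sum_mul, Fin.sum_univ_eq_sum_range (fun k => (n.choose k : ℝ)), ← Nat.cast_sum,
    Nat.sum_range_choose, Nat.cast_pow, Nat.cast_ofNat, ← mul_pow]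
  norm_num

/-- The average over the arrival orders. -/
noncomputable def averageOrder (f : Equiv.Perm (Fin n) → ℝ) : ℝ := 1 / (n.factorial : ℝ) * ∑ π, f π

lemma averageOrder_mono {f g : Equiv.Perm (Fin n) → ℝ} (h : ∀ π, f π ≤ g π) :
    averageOrder f ≤ averageOrder g :=
  mul_le_mul_of_nonneg_left (sum_le_sum fun π _ => h π) (by positivity)

lemma averageOrder_const (x : ℝ) : averageOrder (fun _ : Equiv.Perm (Fin n) => x) = x := by
  have : (n.factorial : ℝ) ≠ 0 := by positivity
  rw [averageOrder, sum_const, card_univ, Fintype.card_perm, Fintype.card_fin, nsmul_eq_mul]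
  field_simp

/-- The expected value of the prediction-based mechanism given the arrival order. -/
noncomputable def predictionValue (I : Instance n) (P : Params) (ω : ℝ) (π : Equiv.Perm (Fin n)) : ℝ :=
  P.p * I.value (predictionMech I P.a P.z ω π true 0).hired +
    (1 - P.p) * ((∑ j, I.value (predictionMech I P.a P.z ω π false j).hired) / 2)

/-- The expected value of posted prices after sampling, given the arrival order. -/
noncomputable def samplePostedValue (I : Instance n) (alg : Finset (Fin n) → Finset (Fin n)) (β : ℝ)
    (π : Equiv.Perm (Fin n)) : ℝ :=
  ∑ ξ : Fin (n + 1), ((n.choose ξ : ℝ) * (1 / 2) ^ n) *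
    ((∑ j, I.value (samplingMech I alg β π false ξ j).hired) / 2)

/-- The expected value of the sampling-based mechanism given the arrival order. -/
noncomputable def samplingValue (I : Instance n) (alg : Finset (Fin n) → Finset (Fin n)) (P : Params)
    (π : Equiv.Perm (Fin n)) : ℝ :=
  P.q * I.value (dynkin I π).hired + (1 - P.q) * samplePostedValue I alg P.β π

lemma expectedValue_eq (I : Instance n) (alg : Finset (Fin n) → Finset (Fin n)) (P : Params)
    (τ ω : ℝ) : expectedValue I alg P τ ω =
      τ * averageOrder (predictionValue I P ω) +
        (1 - τ) * averageOrder (samplingValue I alg P) := by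
  have key : ∀ π : Equiv.Perm (Fin n),
      ∑ c₀ : Bool, ∑ c₁ : Bool, ∑ c₂ : Bool, ∑ ξ : Fin (n + 1), ∑ j : Fin 2,
        seedProb τ P ⟨π, c₀, c₁, c₂, ξ, j⟩ *
          I.value (combinedMech I alg P ω ⟨π, c₀, c₁, c₂, ξ, j⟩).hired =
      1 / (n.factorial : ℝ) *
        (τ * predictionValue I P ω π + (1 - τ) * samplingValue I alg P π) := by
    intro π
    -- In each branch the weights of the coins it ignores add up to `1`. The sample size stays fixed
    -- here, because only the sampled posted prices depend on it.
    have hterm : ∀ ξ : Fin (n + 1), ∑ c₀ : Bool, ∑ c₁ : Bool, ∑ c₂ : Bool, ∑ j : Fin 2,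
        seedProb τ P ⟨π, c₀, c₁, c₂, ξ, j⟩ *
          I.value (combinedMech I alg P ω ⟨π, c₀, c₁, c₂, ξ, j⟩).hired =
        1 / (n.factorial : ℝ) *
          (((n.choose ξ : ℝ) * (1 / 2) ^ n) *
            (τ * predictionValue I P ω π + (1 - τ) * P.q * I.value (dynkin I π).hired) +
          (1 - τ) * (1 - P.q) * (((n.choose ξ : ℝ) * (1 / 2) ^ n) *
            ((∑ j, I.value (samplingMech I alg P.β π false ξ j).hired) / 2))) := by
      intro ξ
      simp only [Fintype.sum_bool, Fin.sum_univ_two, seedProb, coinProb, combinedMech,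
        predictionValue, predictionMech, samplingMech, if_true, Bool.false_eq_true, if_false]
      ring
    have hswap : ∀ F : Bool → Bool → Bool → Fin (n + 1) → ℝ,
        ∑ c₀, ∑ c₁, ∑ c₂, ∑ ξ, F c₀ c₁ c₂ ξ = ∑ ξ, ∑ c₀, ∑ c₁, ∑ c₂, F c₀ c₁ c₂ ξ := by
      intro F
      simp only [Fintype.sum_bool, sum_add_distrib]
    rw [hswap, sum_congr rfl fun ξ _ => hterm ξ, ← mul_sum, sum_add_distrib, ← sum_mul,
      sum_binomial, ← mul_sum, samplingValue, samplePostedValue]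
    ring
  unfold expectedValue expectation
  rw [sum_congr rfl fun π _ => key π, ← mul_sum, sum_add_distrib, ← mul_sum, ← mul_sum,
    averageOrder, averageOrder]
  ring

/-! ### The prediction-based mechanism -/

lemma predictionValue_nonneg {I : Instance n} {P : Params} (hp0 : 0 ≤ P.p) (hp1 : P.p ≤ 1)
    (ω : ℝ) (π : Equiv.Perm (Fin n)) : 0 ≤ predictionValue I P ω π :=
  add_nonneg (mul_nonneg hp0 (I.value_nonneg _))
    (mul_nonneg (by linarith) (div_nonneg (sum_nonneg fun _ _ => I.value_nonneg _) (by norm_num)))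

lemma le_predictionValue {I : Instance n} {P : Params} (hp : P.p = 0.33) (ha : P.a = 0.335)
    (hz : P.z = 2) {O : Finset (Fin n)} (hO : Feasible I univ O) {δ : ℝ} (hδ0 : 0 < δ)
    (hδ1 : δ ≤ 1) (π : Equiv.Perm (Fin n)) :
    δ * I.value O / 19 ≤ predictionValue I P (δ * I.value O) π := by
  rcases (I.value_nonneg O).eq_or_lt with h0 | hV
  · rw [← h0]
    simpa using predictionValue_nonneg (by rw [hp]; norm_num) (by rw [hp]; norm_num) _ π
  set V := I.value O
  have hδV : 0 < δ * V := by positivity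
  have hδV' : δ * V ≤ V := mul_le_of_le_one_left hV.le hδ1
  unfold predictionValue
  simp only [predictionMech, if_true, Bool.false_eq_true, if_false]
  rw [hp, ha, hz]
  have hpost := sum_postedPrice_nonneg I (0.335 * (δ * V)) (arrivals π)
  by_cases h : ∃ i, 0.335 * (δ * V) / 2 ≤ I.value {i}
  · obtain ⟨i, hi⟩ := h
    have hfirst : 0.335 * (δ * V) / 2 ≤ I.value (hireOne I ((arrivals π).find?
        fun i => decide (0.335 * (δ * V) / 2 ≤ I.value {i}))).hired := by
      cases hf : (arrivals π).find? fun i => decide (0.335 * (δ * V) / 2 ≤ I.value {i}) with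
      | none =>
        have := List.find?_eq_none.mp hf i (mem_arrivals π i)
        exact absurd hi (by simpa using this)
      | some x =>
        have := List.find?_some hf
        rw [decide_eq_true_eq] at this
        exact this
    linarith
  · push Not at h
    -- `0.0825 = (1 - 2 * 0.335) / 4` makes the condition on `O` tight at `δ = 1`. The parameters
    -- balance the two cases: `0.33 * 0.335 / 2 = 0.67 * 0.0825 = 0.055275 > 1/19`.
    have h1 := postedPrice_value (I := I) (t := 0.335 * (δ * V)) (m := 0.335 * (δ * V) / 2)
      (by positivity) (fun i => (h i).le) (nodup_arrivals π) (O := O)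
      ⟨fun i _ => by simpa using mem_arrivals π i, hO.2⟩ (x := 0.0825 * (δ * V))
      (by linarith) (by
        change _ ≤ V
        linarith)
    have h2 := I.value_nonneg (hireOne I ((arrivals π).find?
        fun i => decide (0.335 * (δ * V) / 2 ≤ I.value {i}))).hired
    linarith

/-! ### The sampling-based mechanism -/

lemma samplePostedValue_nonneg (I : Instance n) (alg : Finset (Fin n) → Finset (Fin n)) (β : ℝ)
    (π : Equiv.Perm (Fin n)) : 0 ≤ samplePostedValue I alg β π :=
  sum_nonneg fun _ _ => mul_nonneg (by positivity)
    (div_nonneg (sum_nonneg fun _ _ => I.value_nonneg _) (by norm_num))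

lemma Feasible.subset {I : Instance n} {N' S U : Finset (Fin n)} (h : Feasible I N' U)
    (hSU : S ⊆ U) {N : Finset (Fin n)} (hSN : S ⊆ N) : Feasible I N S :=
  ⟨hSN, (sum_le_sum_of_subset_of_nonneg hSU fun i _ _ => (I.cost_pos i).le).trans h.2⟩

/-- The valuation is monotone on the subsets of an optimal solution. -/
lemma IsOptimal.marginal_nonneg {I : Instance n} {O : Finset (Fin n)} (hO : IsOptimal I O)
    {i : Fin n} (hi : i ∈ O) {S : Finset (Fin n)} (hS : S ⊆ O) (hiS : i ∉ S) :
    0 ≤ marginal I.value i S := by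
  -- The marginal of `i` is smallest when she is added last, and there it is nonnegative because `O`
  -- without `i` is still feasible.
  have h1 := I.submodular S (O.erase i) (fun x hx => mem_erase.mpr
    ⟨fun e => hiS (e ▸ hx), hS hx⟩) i (notMem_erase i O)
  refine le_trans ?_ h1
  rw [marginal, insert_erase hi, sub_nonneg]
  exact hO.2 _ (hO.1.subset (erase_subset _ _) (subset_univ _))

/-- An optimal solution is rarely split in a very unbalanced way. -/
lemma IsOptimal.card_balanced {I : Instance n} {O : Finset (Fin n)} (hO : IsOptimal I O)
    (hV : 0 < I.value O) {m : ℝ} (hm : ∀ i, I.value {i} ≤ m) :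
    (I.value O - 50 * m) * 2 ^ n ≤
      (#{S : Finset (Fin n) | 2 / 5 * I.value O ≤ I.value (S ∩ O) ∧
        2 / 5 * I.value O ≤ I.value (Sᶜ ∩ O)} : ℝ) * I.value O := by
  set V := I.value O with hVdef
  set f : Finset (Fin n) → ℝ := fun S => I.value (S ∩ O) with hf
  have hm0 : 0 ≤ m := by
    by_cases hn : Nonempty (Fin n)
    · obtain ⟨i⟩ := hn
      exact (I.value_nonneg {i}).trans (hm i)
    · have : O = ∅ := by
        rw [not_nonempty_iff] at hn
        exact Subsingleton.elim _ _
      rw [hVdef, this, I.value_empty] at hV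
      exact absurd hV (lt_irrefl 0)
  have hdiff : ∀ S : Finset (Fin n), ∀ i, f (insert i S) - f S =
      if i ∈ O then marginal I.value i (S ∩ O) else 0 := by
    intro S i
    simp only [hf]
    split_ifs with hi
    · rw [insert_inter_of_mem hi, marginal]
    · rw [insert_inter_of_notMem hi, sub_self]
  have hbad := card_filter_lt_mul_le (m := m) hV f (by simp [hf, I.value_empty]) ?_ ?_ ?_
  rotate_left
  · intro S U hSU i hi
    rw [hdiff, hdiff]
    split_ifs
    · exact I.submodular _ _ (inter_subset_inter_right hSU) i (by simp [hi])
    · exact le_rfl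
  · intro S i hi
    rw [hdiff]
    split_ifs with hiO
    · exact ⟨hO.marginal_nonneg hiO inter_subset_right (by simp [hi]),
        (I.marginal_le_single (by simp [hi])).trans (hm i)⟩
    · exact ⟨le_rfl, hm0⟩
  · intro S
    have := I.value_union_le_add (S ∩ O) (Sᶜ ∩ O)
    rwa [← union_inter_distrib_right, union_compl, univ_inter] at this
  rw [Fintype.card_fin] at hbad
  set bad : Finset (Finset (Fin n)) := {S | f S < 2 / 5 * V} with hbaddef
  set good : Finset (Finset (Fin n)) := {S : Finset (Fin n) | 2 / 5 * V ≤ I.value (S ∩ O) ∧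
    2 / 5 * V ≤ I.value (Sᶜ ∩ O)} with hgood
  -- A set that is not balanced is bad or has a bad complement, which doubles `25` to `50`.
  have hcover : (univ : Finset (Finset (Fin n))) ⊆ good ∪ (bad ∪ bad.image compl) := by
    intro S _
    by_cases h1 : 2 / 5 * V ≤ I.value (S ∩ O)
    · by_cases h2 : 2 / 5 * V ≤ I.value (Sᶜ ∩ O)
      · exact mem_union_left _ (by simp [hgood, h1, h2])
      · refine mem_union_right _ (mem_union_right _ (mem_image.mpr ⟨Sᶜ, ?_, compl_compl S⟩))
        simpa [hbaddef, hf] using h2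
    · refine mem_union_right _ (mem_union_left _ ?_)
      simpa [hbaddef, hf] using h1
  have hcard : 2 ^ n ≤ #good + (#bad + #bad) := by
    have h1 := (card_le_card hcover).trans (card_union_le _ _)
    have h2 := card_union_le bad (bad.image compl)
    have h3 : #(bad.image compl) ≤ #bad := card_image_le
    rw [card_univ, Fintype.card_finset, Fintype.card_fin] at h1
    omega
  have hcard' : (2 : ℝ) ^ n ≤ #good + (#bad + #bad) := by exact_mod_cast hcard
  have := mul_le_mul_of_nonneg_right hcard' hV.le
  linarith

/-- On a balanced split the threshold lies between `β * 0.3678 * (2/5) V` and `βV`, where `0.3678 <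
1/e`, and the later agents still contain a feasible set worth `2V/5`; posted prices then earn `x`.
Unbalanced splits are counted as `0`, and the probability bound is multiplied through by `V`. -/
lemma le_averageOrder_samplePostedValue {I : Instance n}
    {alg : Finset (Fin n) → Finset (Fin n)} (halg : IsApproxAlgorithm I alg)
    {O : Finset (Fin n)} (hO : IsOptimal I O) (hV : 0 < I.value O) {m β x : ℝ} (hβ : 0 < β)
    (hm : ∀ i, I.value {i} ≤ m) (hx0 : 0 ≤ x) (hx1 : 2 * x ≤ β * (0.3678 * (2 / 5 * I.value O)) - m)
    (hx2 : 4 * x + 2 * (β * I.value O) ≤ 2 / 5 * I.value O) :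
    (I.value O - 50 * m) * x ≤ I.value O * averageOrder (samplePostedValue I alg β) := by
  set V := I.value O with hVdef
  set good : Finset (Finset (Fin n)) := {S : Finset (Fin n) | 2 / 5 * V ≤ I.value (S ∩ O) ∧
    2 / 5 * V ≤ I.value (Sᶜ ∩ O)} with hgood
  have hpt : ∀ (π : Equiv.Perm (Fin n)) (ξ : Fin (n + 1)),
      (if ((arrivals π).take ξ).toFinset ∈ good then x else 0) ≤
        (∑ j, I.value (samplingMech I alg β π false ξ j).hired) / 2 := by
    intro π ξ
    simp only [samplingMech, Bool.false_eq_true, if_false]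
    set S := ((arrivals π).take ξ).toFinset with hS
    split_ifs with hg
    · obtain ⟨hg1, hg2⟩ := (mem_filter.mp hg).2
      have hT1 := (halg S).2 (S ∩ O) (hO.1.subset inter_subset_right inter_subset_left)
      have hT2 : I.value (alg S) ≤ V := hO.2 _ ⟨subset_univ _, (halg S).1.2⟩
      have he : 0.3678 ≤ 1 / Real.exp 1 := by
        rw [le_div_iff₀ (Real.exp_pos 1)]
        have := Real.exp_one_lt_d9
        linarith
      have hT3 : 0.3678 * (2 / 5 * V) ≤ I.value (alg S) :=
        (mul_le_mul he hg1 (by positivity) (by positivity)).trans hT1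
      have hT0 : 0 < I.value (alg S) := lt_of_lt_of_le (by positivity) hT3
      have hb1 := mul_le_mul_of_nonneg_left hT3 hβ.le
      have hb2 := mul_le_mul_of_nonneg_left hT2 hβ.le
      have := postedPrice_value (I := I) (mul_pos hβ hT0) hm
        ((nodup_arrivals π).sublist (List.drop_sublist ξ _)) (O := Sᶜ ∩ O) (x := x)
        (hO.1.subset inter_subset_right
          (by rw [toFinset_drop_arrivals]; exact inter_subset_left))
        (by linarith) (by linarith)
      linarith
    · exact div_nonneg (sum_postedPrice_nonneg _ _ _) (by norm_num)
  have h1 : averageOrder (fun π : Equiv.Perm (Fin n) => ∑ ξ : Fin (n + 1),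
      ((n.choose ξ : ℝ) * (1 / 2) ^ n) *
        (if ((arrivals π).take ξ).toFinset ∈ good then x else 0)) ≤
      averageOrder (samplePostedValue I alg β) :=
    averageOrder_mono fun π => sum_le_sum fun ξ _ =>
      mul_le_mul_of_nonneg_left (hpt π ξ) (by positivity)
  rw [averageOrder, average_take_arrivals (fun S => if S ∈ good then x else 0), sum_ite_mem,
    univ_inter, sum_const, nsmul_eq_mul] at h1
  have h2 := hO.card_balanced hV hm
  rw [← hVdef, ← hgood] at h2
  have h3 := mul_le_mul_of_nonneg_right h2 (by positivity : 0 ≤ x * (1 / 2 : ℝ) ^ n)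
  have h4 := mul_le_mul_of_nonneg_left h1 hV.le
  have h5 : (2 : ℝ) ^ n * (1 / 2) ^ n = 1 := by rw [← mul_pow]; norm_num
  calc (V - 50 * m) * x = (V - 50 * m) * x * ((2 : ℝ) ^ n * (1 / 2) ^ n) := by rw [h5, mul_one]
    _ ≤ _ := by linarith

lemma samplingValue_nonneg {I : Instance n} {alg : Finset (Fin n) → Finset (Fin n)} {P : Params}
    (hq0 : 0 ≤ P.q) (hq1 : P.q ≤ 1) (π : Equiv.Perm (Fin n)) : 0 ≤ samplingValue I alg P π :=
  add_nonneg (mul_nonneg hq0 (I.value_nonneg _))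
    (mul_nonneg (by linarith) (samplePostedValue_nonneg _ _ _ _))

lemma le_averageOrder_samplingValue {I : Instance n} {alg : Finset (Fin n) → Finset (Fin n)}
    (halg : IsApproxAlgorithm I alg) {O : Finset (Fin n)} (hO : IsOptimal I O) {P : Params}
    (hP : P = consistencyParams ∨ P = robustnessParams) :
    I.value O / 445 ≤ averageOrder (samplingValue I alg P) := by
  have hP' : (P.q = 0.66 ∧ P.β = 0.1664) ∨ (P.q = 0.63 ∧ P.β = 0.171) := by
    rcases hP with rfl | rfl
    · exact Or.inl ⟨rfl, rfl⟩
    · exact Or.inr ⟨rfl, rfl⟩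
  rcases (I.value_nonneg O).eq_or_lt with h0 | hV
  · rw [← h0, zero_div, ← averageOrder_const (n := n) 0]
    refine averageOrder_mono fun π => samplingValue_nonneg ?_ ?_ π <;>
      rcases hP' with h | h <;> rw [h.1] <;> norm_num
  have hne : (univ : Finset (Fin n)).Nonempty := by
    by_contra hcon
    rw [not_nonempty_iff_eq_empty] at hcon
    have : O = ∅ := subset_empty.mp (hcon ▸ subset_univ O)
    rw [this, I.value_empty] at hV
    exact lt_irrefl 0 hV
  obtain ⟨b, -, hb⟩ := exists_forall_atMost I hne
  have hb : ∀ i, AtMost I i b := fun i => hb i (mem_univ i)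
  have hm : ∀ i, I.value {i} ≤ I.value {b} := fun i => (hb i).le
  have hm0 := I.value_nonneg {b}
  have hD : I.value {b} / 5 ≤ averageOrder fun π => I.value (dynkin I π).hired := by
    have h1 := le_sum_dynkin I hb
    have h2 : (0 : ℝ) < n.factorial := by positivity
    rw [averageOrder, one_div_mul_eq_div, le_div_iff₀ h2]
    linarith
  have hS0 : 0 ≤ averageOrder (samplePostedValue I alg P.β) := by
    rw [← averageOrder_const (n := n) 0]
    exact averageOrder_mono fun π => samplePostedValue_nonneg _ _ _ π
  have hsplit : averageOrder (samplingValue I alg P) =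
      P.q * averageOrder (fun π => I.value (dynkin I π).hired) +
        (1 - P.q) * averageOrder (samplePostedValue I alg P.β) := by
    simp only [averageOrder, samplingValue, sum_add_distrib, ← mul_sum]
    ring
  rw [hsplit]
  set V := I.value O with hVdef
  set m := I.value {b} with hmdef
  set D := averageOrder fun π => I.value (dynkin I π).hired
  -- A dominant agent makes Dynkin's branch sufficient alone: `q / 250 > 1/445`.
  by_cases hmV : V ≤ 50 * m
  · rcases hP' with ⟨hq, hβ⟩ | ⟨hq, hβ⟩ <;> rw [hq] <;> linarith
  · push Not at hmV
    have hS : ∀ x, 0 ≤ x → 2 * x ≤ P.β * (0.3678 * (2 / 5 * V)) - m →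
        4 * x + 2 * (P.β * V) ≤ 2 / 5 * V →
        (V - 50 * m) * x ≤ V * averageOrder (samplePostedValue I alg P.β) := fun x h0 h1 h2 =>
      le_averageOrder_samplePostedValue halg hO hV
        (by rcases hP' with h | h <;> rw [h.2] <;> norm_num) hm h0 h1 h2
    refine le_of_mul_le_mul_left ?_ hV
    have hDV := mul_le_mul_of_nonneg_left hD hV.le
    rcases hP' with ⟨hq, hβ⟩ | ⟨hq, hβ⟩
    · have := hS ((0.1664 * (0.3678 * (2 / 5 * V)) - m) / 2) (by linarith)
        (by rw [hβ]; linarith) (by rw [hβ]; linarith)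
      rw [hq]
      -- `0.01448` approximates the minimiser of the quadratic `q u / 5 + (1 - q) (1 - 50 u) x / V`
      -- in `u = m / V`; with the other parameters it is near `0.01577`.
      nlinarith [sq_nonneg (m - 0.01448 * V), mul_pos hV hV]
    · have := hS ((0.171 * (0.3678 * (2 / 5 * V)) - m) / 2) (by linarith)
        (by rw [hβ]; linarith) (by rw [hβ]; linarith)
      rw [hq]
      nlinarith [sq_nonneg (m - 0.01577 * V), mul_pos hV hV]

/-! ### The combined mechanism -/

/-- The guarantee of the combined mechanism, for a prediction that is a fraction `δ` of the
optimum. -/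
lemma value_le_expectedValue {I : Instance n} {alg : Finset (Fin n) → Finset (Fin n)}
    (halg : IsApproxAlgorithm I alg) {O : Finset (Fin n)} (hO : IsOptimal I O) {P : Params}
    (hP : P = consistencyParams ∨ P = robustnessParams) {τ : ℝ} (hτ0 : 0 ≤ τ) (hτ1 : τ < 1)
    {δ : ℝ} (hδ0 : 0 < δ) (hδ1 : δ ≤ 1) :
    I.value O ≤ (τ * (1 / 19) * δ + (1 - τ) * (1 / 445))⁻¹ *
      expectedValue I alg P τ (δ * I.value O) := by
  have hpred : δ * I.value O / 19 ≤ averageOrder (predictionValue I P (δ * I.value O)) := by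
    rw [← averageOrder_const (n := n) (δ * I.value O / 19)]
    refine averageOrder_mono fun π => le_predictionValue ?_ ?_ ?_ hO.1 hδ0 hδ1 π <;>
      rcases hP with rfl | rfl <;> rfl
  have h1 := mul_le_mul_of_nonneg_left hpred hτ0
  have h2 := mul_le_mul_of_nonneg_left (le_averageOrder_samplingValue halg hO hP)
    (by linarith : 0 ≤ 1 - τ)
  have h3 : 0 < τ * (1 / 19) * δ + (1 - τ) * (1 / 445) :=
    add_pos_of_nonneg_of_pos (by positivity) (mul_pos (by linarith) (by norm_num))
  rw [expectedValue_eq, inv_mul_eq_div, le_div_iff₀ h3]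
  linarith

/-- Almost sure statements concern seeds of nonzero weight; at tolerance zero these never select the
prediction-based branch. -/
lemma combinedMech_eq_of_tolerance_zero (I : Instance n)
    (alg : Finset (Fin n) → Finset (Fin n)) (P : Params) {s : Seed n} (hs : seedProb 0 P s ≠ 0)
    (ω ω' : ℝ) : combinedMech I alg P ω s = combinedMech I alg P ω' s := by
  have hc : s.coinMix = false := by
    by_contra h
    rw [Bool.not_eq_false] at h
    exact hs (by simp [seedProb, coinProb, h])
  simp [combinedMech, hc]

end BudgetMech

theorem mainTheorem7 {n : ℕ} (I : BudgetMech.Instance n)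
    (alg : Finset (Fin n) → Finset (Fin n)) (halg : BudgetMech.IsApproxAlgorithm I alg)
    (Sopt : Finset (Fin n)) (hopt : BudgetMech.IsOptimal I Sopt) :
    -- consistency: perfect prediction
    (∀ τ : ℝ, 0 ≤ τ → τ < 1 →
      I.value Sopt ≤ (τ * (1 / 19) + (1 - τ) * (1 / 445))⁻¹ *
        BudgetMech.expectedValue I alg BudgetMech.consistencyParams τ (I.value Sopt)) ∧
    -- robustness: prediction with relative error `ε`
    (∀ τ : ℝ, 0 ≤ τ → τ < 1 → ∀ ε : ℝ, 0 < ε → ε < 1 →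
      I.value Sopt ≤ (τ * (1 / 19) * (1 - ε) + (1 - τ) * (1 / 445))⁻¹ *
        BudgetMech.expectedValue I alg BudgetMech.robustnessParams τ
          ((1 - ε) * I.value Sopt)) ∧
    -- tolerance zero: the outcome does not depend on the prediction (almost surely), and the
    -- mechanism is 445-competitive whatever the prediction is
    (∀ P : BudgetMech.Params,
      P = BudgetMech.consistencyParams ∨ P = BudgetMech.robustnessParams →
      (∀ s : BudgetMech.Seed n, BudgetMech.seedProb 0 P s ≠ 0 → ∀ ω ω' : ℝ,
        BudgetMech.combinedMech I alg P ω s = BudgetMech.combinedMech I alg P ω' s) ∧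
      ∀ ω : ℝ, I.value Sopt ≤ 445 * BudgetMech.expectedValue I alg P 0 ω) := by
  refine ⟨?_, ?_, ?_⟩
  · intro τ h0 h1
    simpa using BudgetMech.value_le_expectedValue halg hopt (Or.inl rfl) h0 h1 one_pos le_rfl
  · intro τ h0 h1 ε hε0 hε1
    exact BudgetMech.value_le_expectedValue halg hopt (Or.inr rfl) h0 h1 (by linarith)
      (by linarith)
  · intro P hP
    refine ⟨fun s hs => BudgetMech.combinedMech_eq_of_tolerance_zero I alg P hs, fun ω => ?_⟩
    have := BudgetMech.le_averageOrder_samplingValue halg hopt hP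
    rw [BudgetMech.expectedValue_eq]
    linarith
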